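/- Let $\overline{\mathbb D}=\{z\in\mathbb C:|z|\le 1\}$. A Leja sequence for $\overline{\mathbb D}$ is a sequence $(\eta_1,\eta_2,\dots)$ of points of $\overline{\mathbb D}$ such that $|\eta_1|=1$ and, for every $k\ge 2$, $$\sup_{z\in\overline{\mathbb D}}\ \prod_{j=1}^{k-1}|z-\eta_j|=\prod_{j=1}^{k-1}|\eta_k-\eta_j| .$$ For such a sequence (whose terms are pairwise distinct), $N\ge1$ and $1\le k\le N$, let $$l_k^{(N)}(z)=\prod_{j=1,\,j\ne k}^{N}\frac{z-\eta_j}{\eta_k-\eta_j}$$ be the associated fundamental Lagrange interpolation polynomials. Theorem. There is a function $\varepsilon$, not depending on the Leja sequence, with $\lim_{p\to+\infty}\varepsilon(1/p)=0$ ($p$ ranging over the positive integers), such that for every Leja sequence for $\overline{\mathbb D}$ one has $$\lim_{p\to+\infty}\left[\frac1{2^p-1}\sum_{k=1}^{2^p-1}\ \sup_{z\in\overline{\mathbb D}}\bigl|l_k^{(2^p-1)}(z)\bigr|\right]=1,$$ and, more precisely, for all integers $p\ge 2$, $$2^p-1\;<\;\sum_{k=1}^{2^p-1}\ \sup_{z\in\overline{\mathbb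 D}}\bigl|l_k^{(2^p-1)}(z)\bigr|\;\le\;\bigl(1+\varepsilon(1/p)\bigr)\,(2^p-1).$$ -/

import Mathlib

open Filter Topology

/-- A sequence `η 0, η 1, …` of points of a compact set `K ⊂ ℂ` (indexed from `0`) is a *Leja
sequence* for `K` if `η 0 ∈ ∂K` and, for every `k ≥ 1`,
`sup_{z ∈ K} ∏_{j < k} |z - η j| = ∏_{j < k} |η k - η j|`. -/
def IsLejaSequence (K : Set ℂ) (η : ℕ → ℂ) : Prop :=
  (∀ k, η k ∈ K) ∧ η 0 ∈ frontier K ∧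
    ∀ k, 1 ≤ k →
      IsLUB ((fun z : ℂ => ∏ j ∈ Finset.range k, ‖z - η j‖) '' K)
        (∏ j ∈ Finset.range k, ‖η k - η j‖)

/-- The fundamental Lagrange interpolation polynomial
`z ↦ ∏_{j < N, j ≠ k} (z - η j) / (η k - η j)` of the `N`-section `η 0, …, η (N - 1)`,
for `k < N`. -/
noncomputable def fundLagrange (η : ℕ → ℂ) (N k : ℕ) : Polynomial ℂ :=
  Lagrange.basis (Finset.range N) η k

/-- The sum over `k < N` of the sup norms on the closed unit disk of the fundamental Lagrange
interpolation polynomials of the `N`-section of `η`. -/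
noncomputable def sumSupFundLagrange (η : ℕ → ℂ) (N : ℕ) : ℝ :=
  ∑ k ∈ Finset.range N,
    sSup ((fun z : ℂ => ‖(fundLagrange η N k).eval z‖) '' Metric.closedBall (0 : ℂ) 1)

/-! Write M = 2 ^ p and n = M - 1. By doubling, the first M points of a Leja sequence are all the
M-th roots of a = η 0 ^ M. Indeed, if the first M points are those roots, the first 2M + i
differences with M factored out read |z ^ M - a| · ∏ |z - η (M + j)|. The first factor is at most 2
on the disk, and equals 2 wherever z ^ M = -a. By induction the second factor can be maximized at
such a z, so the next M points again form a Leja section, which fills the roots of -a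
(`IsLejaSection.shift`, `IsLejaSection.prod_sub_eq`).

Dropping the last point c leaves n nodes. With G_w(z) = (z ^ M - w ^ M) / (z - w), one has M ·
|l_k(z)| = |G_{η k}(z) - G_c(z)|. Each G_w is at most M in modulus, and at most 2 / |z - w|; since z
cannot be close to both η k and c, sup |l_k| ≤ 1 + 4 / (M |η k - c|). Summed over the roots, the
error is at most 2 (1 + log n), negligible against n.

For the lower bound, l_k(η k) = 1 gives n, and the node next to c makes the inequality strict. -/

open Finset in
/-- `η 0, …, η (n - 1)` is the beginning of a Leja sequence of the closed unit disk. -/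
structure IsLejaSection (η : ℕ → ℂ) (n : ℕ) : Prop where
  norm_le : ∀ k < n, ‖η k‖ ≤ 1
  norm_zero : ‖η 0‖ = 1
  prod_le : ∀ k < n, 1 ≤ k → ∀ z : ℂ, ‖z‖ ≤ 1 →
    ∏ j ∈ range k, ‖z - η j‖ ≤ ∏ j ∈ range k, ‖η k - η j‖

theorem IsLejaSection.mono {η : ℕ → ℂ} {m n : ℕ} (h : IsLejaSection η n) (hmn : m ≤ n) :
    IsLejaSection η m :=
  ⟨fun k hk => h.norm_le k (hk.trans_le hmn), h.norm_zero,
    fun k hk => h.prod_le k (hk.trans_le hmn)⟩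

theorem IsLejaSection.congr {η μ : ℕ → ℂ} {n : ℕ} (h : IsLejaSection η n) (hn : 1 ≤ n)
    (hμ : ∀ j < n, μ j = η j) : IsLejaSection μ n := by
  refine ⟨fun k hk => by rw [hμ k hk]; exact h.norm_le k hk,
    by rw [hμ 0 hn]; exact h.norm_zero, fun k hk hk1 z hz => ?_⟩
  have key : ∀ w : ℂ, ∏ j ∈ Finset.range k, ‖w - μ j‖ = ∏ j ∈ Finset.range k, ‖w - η j‖ :=
    fun w => Finset.prod_congr rfl fun j hj => by
      rw [hμ j ((Finset.mem_range.mp hj).trans hk)]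
  rw [key, key, hμ k hk]
  exact h.prod_le k hk hk1 z hz

/-! ### Extending finite Leja sections -/

theorem exists_prod_norm_sub_pos (η : ℕ → ℂ) (k : ℕ) :
    ∃ z : ℂ, ‖z‖ ≤ 1 ∧ 0 < ∏ j ∈ Finset.range k, ‖z - η j‖ := by
  have hinf : (Metric.closedBall (0 : ℂ) 1).Infinite :=
    infinite_of_mem_nhds 0 (Metric.closedBall_mem_nhds 0 one_pos)
  obtain ⟨z, hz, hz'⟩ := hinf.exists_notMem_finset ((Finset.range k).image η)
  refine ⟨z, by simpa using hz, Finset.prod_pos fun j hj => norm_pos_iff.mpr ?_⟩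
  rw [sub_ne_zero]
  rintro rfl
  exact hz' (Finset.mem_image_of_mem _ hj)

theorem exists_prod_norm_sub_max (η : ℕ → ℂ) (k : ℕ) :
    ∃ w : ℂ, ‖w‖ ≤ 1 ∧ ∀ z : ℂ, ‖z‖ ≤ 1 →
      ∏ j ∈ Finset.range k, ‖z - η j‖ ≤ ∏ j ∈ Finset.range k, ‖w - η j‖ := by
  obtain ⟨w, hw, h⟩ := (isCompact_closedBall (0 : ℂ) 1).exists_isMaxOn
    ⟨0, by simp⟩ (f := fun z : ℂ => ∏ j ∈ Finset.range k, ‖z - η j‖) (by fun_prop)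
  exact ⟨w, by simpa using hw, fun z hz => h (by simpa using hz)⟩

theorem IsLejaSection.exists_succ {η : ℕ → ℂ} {n : ℕ} (h : IsLejaSection η n) (hn : 1 ≤ n) :
    ∃ μ : ℕ → ℂ, (∀ j < n, μ j = η j) ∧ IsLejaSection μ (n + 1) := by
  obtain ⟨w, hw, hmax⟩ := exists_prod_norm_sub_max η n
  have hμ : ∀ j < n, Function.update η n w j = η j :=
    fun j hj => Function.update_of_ne hj.ne _ _
  have hsec := h.congr hn hμ
  refine ⟨Function.update η n w, hμ, fun k hk => ?_, hsec.norm_zero, fun k hk hk1 z hz => ?_⟩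
  · rcases (Nat.lt_succ_iff.mp hk).lt_or_eq with hk | rfl
    · exact hsec.norm_le k hk
    · simpa using hw
  · rcases (Nat.lt_succ_iff.mp hk).lt_or_eq with hk | rfl
    · exact hsec.prod_le k hk hk1 z hz
    · have key : ∀ x : ℂ, ∏ j ∈ Finset.range k, ‖x - Function.update η k w j‖
          = ∏ j ∈ Finset.range k, ‖x - η j‖ :=
        fun x => Finset.prod_congr rfl fun j hj => by rw [hμ j (Finset.mem_range.mp hj)]
      rw [key, key, Function.update_self]
      exact hmax z hz

theorem IsLejaSection.exists_extend {η : ℕ → ℂ} {n m : ℕ} (h : IsLejaSection η n) (hn : 1 ≤ n)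
    (hnm : n ≤ m) : ∃ μ : ℕ → ℂ, (∀ j < n, μ j = η j) ∧ IsLejaSection μ m := by
  induction m, hnm using Nat.le_induction with
  | base => exact ⟨η, fun _ _ => rfl, h⟩
  | succ m hm ih =>
    obtain ⟨μ, hμ, hs⟩ := ih
    obtain ⟨ν, hν, ht⟩ := hs.exists_succ (hn.trans hm)
    exact ⟨ν, fun j hj => (hν j (hj.trans_le hm)).trans (hμ j hj), ht⟩

/-! ### Leja sections of length 2 ^ p are full sets of roots -/

/-- Equality case of the triangle inequality: by the parallelogram law, ‖w + a‖² ≤ 4 - 4 = 0. -/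
theorem eq_neg_of_two_le_norm_sub {w a : ℂ} (hw : ‖w‖ ≤ 1) (ha : ‖a‖ = 1) (h : 2 ≤ ‖w - a‖) :
    w = -a := by
  have h1 := parallelogram_law_with_norm ℝ w a
  have h2 : ‖w + a‖ = 0 := by
    nlinarith [norm_nonneg (w + a), norm_nonneg w]
  exact eq_neg_of_add_eq_zero_left (norm_eq_zero.mp h2)

theorem exists_pow_eq_of_norm_eq_one {a : ℂ} (ha : ‖a‖ = 1) {M : ℕ} (hM : 0 < M) :
    ∃ z : ℂ, ‖z‖ = 1 ∧ z ^ M = a := by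
  obtain ⟨z, hz⟩ := IsAlgClosed.exists_pow_nat_eq a hM
  refine ⟨z, ?_, hz⟩
  rw [← pow_eq_one_iff_of_nonneg (norm_nonneg z) hM.ne', ← norm_pow, hz, ha]

/-- The second half of a Leja section whose first half is a full set of `M`-th roots of `a` is
again a Leja section, provided Leja sections of length `M` are full sets of `M`-th roots. -/
theorem IsLejaSection.shift {η : ℕ → ℂ} {M : ℕ} {a : ℂ} (hM : 0 < M) (ha : ‖a‖ = 1)
    (hroots : ∀ μ : ℕ → ℂ, IsLejaSection μ M →
      ∀ z, ∏ j ∈ Finset.range M, (z - μ j) = z ^ M - μ 0 ^ M)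
    (h : IsLejaSection η (M + M))
    (hprod : ∀ z, ∏ j ∈ Finset.range M, (z - η j) = z ^ M - a) {i : ℕ} (hi1 : 1 ≤ i)
    (hiM : i ≤ M) : IsLejaSection (fun j => η (M + j)) i ∧ η M ^ M = -a := by
  have hsplit : ∀ i (z : ℂ), ∏ j ∈ Finset.range (M + i), ‖z - η j‖
      = ‖z ^ M - a‖ * ∏ j ∈ Finset.range i, ‖z - η (M + j)‖ := fun i z => by
    rw [Finset.prod_range_add, ← hprod z, norm_prod]
  induction i, hi1 using Nat.le_induction with
  | base =>
    -- Such a z gives |z ^ M - a| the value 2, so `η M` must attain 2 as well, which forces `η M ^ M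
    -- = -a`.
    obtain ⟨z, hz, hza⟩ := exists_pow_eq_of_norm_eq_one (a := -a) (by rwa [norm_neg]) hM
    have h1 := h.prod_le M (by omega) hM z hz.le
    have h2 := hsplit 0
    simp only [add_zero, Finset.prod_range_zero, mul_one] at h2
    rw [h2, h2, hza] at h1
    have h3 : ‖-a - a‖ = 2 := by
      rw [show -a - a = -(2 * a) by ring, norm_neg, norm_mul, ha]; simp
    have hle := h.norm_le M (by omega)
    have h4 : η M ^ M = -a := eq_neg_of_two_le_norm_sub
      (by rw [norm_pow]; exact pow_le_one₀ (norm_nonneg _) hle) ha (h3 ▸ h1)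
    have h5 : ‖η M‖ = 1 := by
      rw [← pow_eq_one_iff_of_nonneg (norm_nonneg _) hM.ne', ← norm_pow, h4, norm_neg, ha]
    refine ⟨⟨fun k hk => ?_, h5, fun k hk hk1 => by omega⟩, h4⟩
    obtain rfl : k = 0 := by omega
    exact hle
  | succ i hi ih =>
    obtain ⟨hs, h4⟩ := ih (by omega)
    -- `hroots` only speaks of length `M`. Completing the shorter section to that length provides a
    -- maximizer `μ i` of the second factor that is also a root of -a, so both factors are maximal
    -- there at once.
    obtain ⟨μ, hμ, ht⟩ := hs.exists_extend hi (show i ≤ M by omega)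
    have hw : μ i ^ M = -a := by
      have h1 := hroots μ ht (μ i)
      rw [Finset.prod_eq_zero (Finset.mem_range.mpr (show i < M by omega)) (sub_self _)] at h1
      have h2 : μ 0 = η M := hμ 0 hi
      rw [sub_eq_zero.mp h1.symm, h2, h4]
    set Q : ℂ → ℝ := fun z => ∏ j ∈ Finset.range i, ‖z - η (M + j)‖ with hQ
    have hQμ : ∀ z, ∏ j ∈ Finset.range i, ‖z - μ j‖ = Q z := fun z =>
      Finset.prod_congr rfl fun j hj => by rw [hμ j (Finset.mem_range.mp hj)]
    have hmax : ∀ z : ℂ, ‖z‖ ≤ 1 → Q z ≤ Q (μ i) := fun z hz => by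
      rw [← hQμ, ← hQμ]; exact ht.prod_le i (by omega) hi z hz
    have hpos : 0 < Q (μ i) := by
      obtain ⟨z, hz, hp⟩ := exists_prod_norm_sub_pos (fun j => η (M + j)) i
      exact hp.trans_le (hmax z hz)
    have hle := h.norm_le (M + i) (by omega)
    have hlow := h.prod_le (M + i) (by omega) (by omega) (μ i) (ht.norm_le i (by omega))
    rw [hsplit, hsplit, hw] at hlow
    have h3 : ‖-a - a‖ = 2 := by
      rw [show -a - a = -(2 * a) by ring, norm_neg, norm_mul, ha]; simp
    rw [h3] at hlow
    change 2 * Q (μ i) ≤ ‖η (M + i) ^ M - a‖ * Q (η (M + i)) at hlow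
    have hupp : ‖η (M + i) ^ M - a‖ ≤ 2 := by
      refine (norm_sub_le _ _).trans ?_
      rw [norm_pow, ha]
      linarith [pow_le_one₀ (n := M) (norm_nonneg (η (M + i))) hle]
    have hQ0 : 0 ≤ Q (η (M + i)) := Finset.prod_nonneg fun _ _ => norm_nonneg _
    -- 2 Q(μ i) ≤ ‖η (M + i) ^ M - a‖ · Q(η (M + i)) ≤ 2 Q(η (M + i)).
    have hQle : Q (μ i) ≤ Q (η (M + i)) := by nlinarith
    refine ⟨⟨fun k hk => h.norm_le _ (by omega), hs.norm_zero, fun k hk hk1 z hz => ?_⟩, h4⟩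
    rcases (Nat.lt_succ_iff.mp hk).lt_or_eq with hk | rfl
    · exact hs.prod_le k hk hk1 z hz
    · exact (hmax z hz).trans hQle

/-- The first `2 ^ p` points of a Leja sequence of the disk are the `2 ^ p`-th roots of
`η 0 ^ 2 ^ p`. -/
theorem IsLejaSection.prod_sub_eq (p : ℕ) : ∀ η : ℕ → ℂ, IsLejaSection η (2 ^ p) →
    ∀ z, ∏ j ∈ Finset.range (2 ^ p), (z - η j) = z ^ 2 ^ p - η 0 ^ 2 ^ p := by
  induction p with
  | zero => intro η _ z; simp
  | succ p ih =>
    intro η h z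
    have hM : 0 < 2 ^ p := by positivity
    have h2 : 2 ^ (p + 1) = 2 ^ p + 2 ^ p := by ring
    rw [h2] at h ⊢
    have hprod := ih η (h.mono (by omega))
    obtain ⟨hs, ha⟩ := h.shift hM (by rw [norm_pow, h.norm_zero, one_pow]) ih hprod
      (i := 2 ^ p) hM le_rfl
    -- The two halves multiply to (z ^ M - a)(z ^ M + a) = z ^ (2M) - a ^ 2.
    rw [Finset.prod_range_add, hprod, ih _ hs, add_zero, ha, pow_add, pow_add]
    ring

theorem IsLejaSequence.isLejaSection {η : ℕ → ℂ}
    (h : IsLejaSequence (Metric.closedBall (0 : ℂ) 1) η) (n : ℕ) : IsLejaSection η n := by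
  obtain ⟨h1, h2, h3⟩ := h
  refine ⟨fun k _ => by simpa using h1 k, ?_, fun k _ hk z hz => ?_⟩
  · rw [frontier_closedBall _ one_ne_zero] at h2
    simpa using h2
  · exact (h3 k hk).1 ⟨z, by simpa using hz, rfl⟩

/-- A repeated point would make the maximal product vanish, but the product is positive somewhere on
the disk. -/
theorem IsLejaSection.injOn {η : ℕ → ℂ} {n : ℕ} (h : IsLejaSection η n) :
    Set.InjOn η (Finset.range n) := by
  have key : ∀ j k, j < k → k < n → η j ≠ η k := fun j k hjk hk heq => by
    obtain ⟨z, hz, hp⟩ := exists_prod_norm_sub_pos η k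
    refine (hp.trans_le (h.prod_le k hk (by omega) z hz)).ne' ?_
    exact Finset.prod_eq_zero (Finset.mem_range.mpr hjk) (by simp [heq])
  intro j hj k hk heq
  have hj := Finset.mem_range.mp hj
  have hk := Finset.mem_range.mp hk
  rcases lt_trichotomy j k with hlt | rfl | hlt
  · exact absurd heq (key j k hlt hk)
  · rfl
  · exact absurd heq.symm (key k j hlt hj)

/-! ### Bounds on the geometric quotient -/

/-- The quotient `(z ^ M - w ^ M) / (z - w)`, evaluated at `z`. -/
noncomputable def geomQuot (M : ℕ) (w z : ℂ) : ℂ := ∑ i ∈ Finset.range M, z ^ i * w ^ (M - 1 - i)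

theorem geomQuot_mul_sub (M : ℕ) (w z : ℂ) : geomQuot M w z * (z - w) = z ^ M - w ^ M :=
  (Commute.all z w).geom_sum₂_mul M

theorem norm_geomQuot_le {M : ℕ} {w z : ℂ} (hw : ‖w‖ ≤ 1) (hz : ‖z‖ ≤ 1) :
    ‖geomQuot M w z‖ ≤ M := by
  refine (norm_sum_le_of_le (n := fun _ => 1) _ fun i _ => ?_).trans (by simp)
  rw [norm_mul, norm_pow, norm_pow]
  exact mul_le_one₀ (pow_le_one₀ (norm_nonneg _) hz) (by positivity)
    (pow_le_one₀ (norm_nonneg _) hw)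

theorem geomQuot_self (M : ℕ) (w : ℂ) : geomQuot M w w = M * w ^ (M - 1) := by
  rw [geomQuot, Finset.sum_congr rfl (g := fun _ => w ^ (M - 1)), Finset.sum_const,
    Finset.card_range, nsmul_eq_mul]
  intro i hi
  rw [← pow_add]
  congr 1
  have := Finset.mem_range.mp hi
  omega

theorem continuous_geomQuot (M : ℕ) (w : ℂ) : Continuous (geomQuot M w) := by
  unfold geomQuot; fun_prop

theorem norm_geomQuot_mul_le {M : ℕ} {w z : ℂ} (hw : ‖w‖ ≤ 1) (hz : ‖z‖ ≤ 1) :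
    ‖geomQuot M w z‖ * ‖z - w‖ ≤ 2 := by
  rw [← norm_mul, geomQuot_mul_sub]
  refine (norm_sub_le _ _).trans ?_
  rw [norm_pow, norm_pow]
  linarith [pow_le_one₀ (n := M) (norm_nonneg w) hw, pow_le_one₀ (n := M) (norm_nonneg z) hz]

/-- Any z is at distance at least ‖v - w‖ / 2 from v or from w. The quotient at that point is at
most 2 / (‖v - w‖ / 2), and the other is at most M. -/
theorem norm_geomQuot_add_le {M : ℕ} {v w z : ℂ} (hv : ‖v‖ ≤ 1) (hw : ‖w‖ ≤ 1) (hz : ‖z‖ ≤ 1)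
    (hvw : v ≠ w) : ‖geomQuot M v z‖ + ‖geomQuot M w z‖ ≤ M + 4 / ‖v - w‖ := by
  have hd : 0 < ‖v - w‖ := norm_pos_iff.mpr (sub_ne_zero.mpr hvw)
  have htri : ‖v - w‖ ≤ ‖z - v‖ + ‖z - w‖ := by
    rw [norm_sub_rev z v]; exact norm_sub_le_norm_sub_add_norm_sub v z w
  have key : ∀ u : ℂ, ‖u‖ ≤ 1 → ‖v - w‖ / 2 ≤ ‖z - u‖ → ‖geomQuot M u z‖ ≤ 4 / ‖v - w‖ := by
    intro u hu hle
    rw [le_div_iff₀ hd]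
    nlinarith [norm_geomQuot_mul_le (M := M) hu hz, norm_nonneg (geomQuot M u z)]
  rcases le_total (‖v - w‖ / 2) ‖z - v‖ with h | h
  · linarith [key v hv h, norm_geomQuot_le (M := M) hw hz]
  · linarith [key w hw (by linarith), norm_geomQuot_le (M := M) hv hz]

/-! ### Lagrange polynomials at the roots with one removed -/

/-- The product of the `z - η j` over the nodes of index `j < n` different from `k`. -/
noncomputable def omitProd (η : ℕ → ℂ) (n k : ℕ) (z : ℂ) : ℂ :=
  ∏ j ∈ (Finset.range n).erase k, (z - η j)

theorem fundLagrange_eval_mul {η : ℕ → ℂ} {n k : ℕ} (hinj : Set.InjOn η (Finset.range n))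
    (hk : k < n) (z : ℂ) :
    (fundLagrange η n k).eval z * omitProd η n k (η k) = omitProd η n k z := by
  rw [fundLagrange, Lagrange.basis, Polynomial.eval_prod, omitProd, omitProd,
    ← Finset.prod_mul_distrib]
  refine Finset.prod_congr rfl fun j hj => ?_
  have hne : η k - η j ≠ 0 := by
    obtain ⟨h1, h2⟩ := Finset.mem_erase.mp hj
    exact sub_ne_zero.mpr fun h => h1 (hinj h2
      (Finset.mem_coe.mpr (Finset.mem_range.mpr hk)) h.symm)
  simp only [Lagrange.basisDivisor, Polynomial.eval_mul, Polynomial.eval_C, Polynomial.eval_sub,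
    Polynomial.eval_X]
  field_simp

/-- `η 0, …, η (n - 1)` together with `c` are all the `(n + 1)`-th roots of `a`. -/
structure IsPuncturedRoots (η : ℕ → ℂ) (n : ℕ) (c a : ℂ) : Prop where
  norm_eq : ‖a‖ = 1
  injOn : Set.InjOn η (Finset.range n)
  ne : ∀ k < n, η k ≠ c
  prod_eq : ∀ z, (∏ j ∈ Finset.range n, (z - η j)) * (z - c) = z ^ (n + 1) - a

namespace IsPuncturedRoots

variable {η : ℕ → ℂ} {n : ℕ} {c a : ℂ}

theorem pow_c (h : IsPuncturedRoots η n c a) : c ^ (n + 1) = a := by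
  have := h.prod_eq c
  rw [sub_self, mul_zero] at this
  exact (sub_eq_zero.mp this.symm)

theorem pow_node (h : IsPuncturedRoots η n c a) {k : ℕ} (hk : k < n) : η k ^ (n + 1) = a := by
  have := h.prod_eq (η k)
  rw [Finset.prod_eq_zero (Finset.mem_range.mpr hk) (sub_self _), zero_mul] at this
  exact (sub_eq_zero.mp this.symm)

theorem norm_root (h : IsPuncturedRoots η n c a) {w : ℂ} (hw : w ^ (n + 1) = a) : ‖w‖ = 1 := by
  rw [← pow_eq_one_iff_of_nonneg (norm_nonneg _) n.succ_ne_zero, ← norm_pow, hw, h.norm_eq]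

theorem omitProd_mul_node (h : IsPuncturedRoots η n c a) {k : ℕ} (hk : k < n) (z : ℂ) :
    omitProd η n k z * (z - c) * (z - η k) = z ^ (n + 1) - a := by
  rw [← h.prod_eq, omitProd, ← Finset.mul_prod_erase _ _ (Finset.mem_range.mpr hk)]
  ring

/-- Cancelling z - η k proves this only off the node; continuity adds the node itself, where the
value gives the denominator of the Lagrange polynomial. -/
theorem omitProd_mul (h : IsPuncturedRoots η n c a) {k : ℕ} (hk : k < n) (z : ℂ) :
    omitProd η n k z * (z - c) = geomQuot (n + 1) (η k) z := by
  have hcont : Continuous fun z => omitProd η n k z * (z - c) := by unfold omitProd; fun_prop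
  refine congrFun (hcont.ext_on (dense_compl_singleton (η k)) (continuous_geomQuot _ _) ?_) z
  intro w hw
  refine mul_right_cancel₀ (sub_ne_zero.mpr hw) ?_
  rw [geomQuot_mul_sub, h.pow_node hk]
  exact h.omitProd_mul_node hk w

theorem omitProd_mul' (h : IsPuncturedRoots η n c a) {k : ℕ} (hk : k < n) (z : ℂ) :
    omitProd η n k z * (z - η k) = geomQuot (n + 1) c z := by
  have hcont : Continuous fun z => omitProd η n k z * (z - η k) := by unfold omitProd; fun_prop
  refine congrFun (hcont.ext_on (dense_compl_singleton c) (continuous_geomQuot _ _) ?_) z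
  intro w hw
  refine mul_right_cancel₀ (sub_ne_zero.mpr hw) ?_
  rw [geomQuot_mul_sub, h.pow_c, ← h.omitProd_mul_node hk w]
  ring

theorem fundLagrange_eval_eq (h : IsPuncturedRoots η n c a) {k : ℕ} (hk : k < n) (z : ℂ) :
    (fundLagrange η n k).eval z * (((n : ℂ) + 1) * η k ^ n) = omitProd η n k z * (η k - c) := by
  rw [← fundLagrange_eval_mul h.injOn hk, mul_assoc, h.omitProd_mul hk, geomQuot_self]
  simp

theorem norm_fundLagrange_eval (h : IsPuncturedRoots η n c a) {k : ℕ} (hk : k < n) (z : ℂ) :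
    ‖(fundLagrange η n k).eval z‖ * (n + 1) = ‖omitProd η n k z‖ * ‖η k - c‖ := by
  rw [← norm_mul, ← h.fundLagrange_eval_eq hk, norm_mul, norm_mul, norm_pow,
    h.norm_root (h.pow_node hk), one_pow, mul_one]
  congr 1
  exact_mod_cast (Complex.norm_natCast (n + 1)).symm

theorem norm_fundLagrange_eval_le (h : IsPuncturedRoots η n c a) {k : ℕ} (hk : k < n) {z : ℂ}
    (hz : ‖z‖ ≤ 1) :
    ‖(fundLagrange η n k).eval z‖ ≤ 1 + 4 / ((n + 1) * ‖η k - c‖) := by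
  have hd : 0 < ‖η k - c‖ := norm_pos_iff.mpr (sub_ne_zero.mpr (h.ne k hk))
  -- From η k - c = (z - c) - (z - η k): the zero at c is traded for a difference of two quotients,
  -- each of which is bounded.
  have h1 : omitProd η n k z * (η k - c) = geomQuot (n + 1) (η k) z - geomQuot (n + 1) c z := by
    rw [← h.omitProd_mul hk, ← h.omitProd_mul' hk]; ring
  have h2 := norm_geomQuot_add_le (M := n + 1) (h.norm_root (h.pow_node hk)).le
    (h.norm_root h.pow_c).le hz (h.ne k hk)
  have h3 : ‖(fundLagrange η n k).eval z‖ * (n + 1) ≤ (n + 1) + 4 / ‖η k - c‖ := by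
    rw [h.norm_fundLagrange_eval hk, ← norm_mul, h1]
    refine (norm_sub_le _ _).trans (h2.trans_eq (by push_cast; ring))
  rw [← le_div_iff₀ (by positivity)] at h3
  refine h3.trans_eq ?_
  field_simp

theorem fundLagrange_eval_node (h : IsPuncturedRoots η n c a) {k : ℕ} (hk : k < n) :
    (fundLagrange η n k).eval (η k) = 1 :=
  Lagrange.eval_basis_self h.injOn (Finset.mem_range.mpr hk)

theorem norm_eval_le_sSup (h : IsPuncturedRoots η n c a) {k : ℕ} (hk : k < n) {z : ℂ}
    (hz : ‖z‖ ≤ 1) : ‖(fundLagrange η n k).eval z‖ ≤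
      sSup ((fun z : ℂ => ‖(fundLagrange η n k).eval z‖) '' Metric.closedBall (0 : ℂ) 1) := by
  refine le_csSup ⟨1 + 4 / ((n + 1) * ‖η k - c‖), ?_⟩ ⟨z, by simpa using hz, rfl⟩
  rintro _ ⟨w, hw, rfl⟩
  exact h.norm_fundLagrange_eval_le hk (by simpa using hw)

theorem sSup_le (h : IsPuncturedRoots η n c a) {k : ℕ} (hk : k < n) :
    sSup ((fun z : ℂ => ‖(fundLagrange η n k).eval z‖) '' Metric.closedBall (0 : ℂ) 1)
      ≤ 1 + 4 / ((n + 1) * ‖η k - c‖) := by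
  refine csSup_le ⟨_, 0, by simp, rfl⟩ ?_
  rintro _ ⟨w, hw, rfl⟩
  exact h.norm_fundLagrange_eval_le hk (by simpa using hw)

theorem exists_node (h : IsPuncturedRoots η n c a) {w : ℂ} (hw : w ^ (n + 1) = a) (hwc : w ≠ c) :
    ∃ k < n, η k = w := by
  have := h.prod_eq w
  rw [hw, sub_self] at this
  obtain ⟨k, hk, h0⟩ := Finset.prod_eq_zero_iff.mp
    ((mul_eq_zero.mp this).resolve_right (sub_ne_zero.mpr hwc))
  exact ⟨k, Finset.mem_range.mp hk, (sub_eq_zero.mp h0).symm⟩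

/-- The order in which the Leja sequence visits the roots is irrelevant to the sum, so the nodes may
be listed by their angle from c. -/
theorem sum_node_eq (h : IsPuncturedRoots η n c a) {ω : ℂ} (hω : IsPrimitiveRoot ω (n + 1))
    (f : ℂ → ℝ) :
    ∑ k ∈ Finset.range n, f (η k) = ∑ i ∈ Finset.range n, f (c * ω ^ (i + 1)) := by
  have hc : c ≠ 0 := by
    rw [← norm_pos_iff, h.norm_root h.pow_c]; exact one_pos
  have hinj : Set.InjOn (fun i => c * ω ^ (i + 1)) (Finset.range n) := by
    intro i hi j hj hij
    have hi := Finset.mem_range.mp hi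
    have hj := Finset.mem_range.mp hj
    have := hω.pow_inj (by omega) (by omega) (mul_left_cancel₀ hc hij)
    omega
  have himg : (Finset.range n).image (fun i => c * ω ^ (i + 1)) = (Finset.range n).image η := by
    refine Finset.eq_of_subset_of_card_le (fun w hw => ?_) ?_
    · obtain ⟨i, hi, rfl⟩ := Finset.mem_image.mp hw
      have hi := Finset.mem_range.mp hi
      obtain ⟨k, hk, hk'⟩ := h.exists_node (w := c * ω ^ (i + 1))
        (by rw [mul_pow, h.pow_c, ← pow_mul, mul_comm (i + 1), pow_mul, hω.pow_eq_one, one_pow,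
          mul_one])
        (fun heq => hω.pow_ne_one_of_pos_of_lt (by omega) (by omega)
          (mul_left_cancel₀ hc (heq.trans (mul_one c).symm)))
      exact Finset.mem_image.mpr ⟨k, Finset.mem_range.mpr hk, hk'⟩
    · rw [Finset.card_image_of_injOn h.injOn, Finset.card_image_of_injOn hinj]
  rw [← Finset.sum_image (f := f) h.injOn, ← himg, Finset.sum_image hinj]

end IsPuncturedRoots

/-! ### Chord lengths between roots of unity -/

/-- Jordan's inequality on each half of [0, 1]. The product t (1 - t) is used because its reciprocal
splits into partial fractions that sum to harmonic numbers. -/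
theorem two_mul_mul_one_sub_le_sin {t : ℝ} (h0 : 0 ≤ t) (h1 : t ≤ 1) :
    2 * (t * (1 - t)) ≤ Real.sin (Real.pi * t) := by
  have hpi := Real.pi_pos
  rcases le_total t (1 / 2) with h | h
  · have := Real.mul_le_sin (x := Real.pi * t) (by positivity) (by nlinarith)
    rw [show 2 / Real.pi * (Real.pi * t) = 2 * t by field_simp] at this
    nlinarith
  · have := Real.mul_le_sin (x := Real.pi * (1 - t)) (by nlinarith) (by nlinarith)
    rw [show 2 / Real.pi * (Real.pi * (1 - t)) = 2 * (1 - t) by field_simp,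
      show Real.pi * (1 - t) = Real.pi - Real.pi * t by ring, Real.sin_pi_sub] at this
    nlinarith

/-- The chord is 2 sin(π t) with t = (i + 1) / (n + 1), and 1 - t = (n - i) / (n + 1). -/
theorem four_mul_le_norm_exp_pow_sub_one {n i : ℕ} (hi : i < n) :
    4 * (((i : ℝ) + 1) * (n - i)) / ((n : ℝ) + 1) ^ 2 ≤
      ‖Complex.exp (2 * Real.pi * Complex.I / ((n + 1 : ℕ) : ℂ)) ^ (i + 1) - 1‖ := by
  have hin : (i : ℝ) + 1 ≤ n := by exact_mod_cast hi
  have h1 : Complex.exp (2 * Real.pi * Complex.I / ((n + 1 : ℕ) : ℂ)) ^ (i + 1)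
      = Complex.exp (Complex.I * ((2 * (Real.pi * ((i + 1) / (n + 1)) ) : ℝ) : ℂ)) := by
    rw [← Complex.exp_nat_mul]
    congr 1
    push_cast
    ring
  rw [h1, Complex.norm_exp_I_mul_ofReal_sub_one, mul_div_cancel_left₀ _ (two_ne_zero)]
  have h2 := two_mul_mul_one_sub_le_sin (t := ((i : ℝ) + 1) / (n + 1)) (by positivity)
    (by rw [div_le_one (by positivity)]; linarith)
  refine le_trans (le_trans (le_of_eq ?_) (mul_le_mul_of_nonneg_left h2 (zero_le_two (α := ℝ))))
    (le_abs_self _)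
  field_simp
  ring

theorem sum_inv_add_one_eq_harmonic (n : ℕ) :
    ∑ i ∈ Finset.range n, 1 / ((i : ℝ) + 1) = (harmonic n : ℝ) := by
  simp [harmonic]

/-! ### Two-sided bound for the sum of sup norms -/

namespace IsPuncturedRoots

variable {η : ℕ → ℂ} {n : ℕ} {c a : ℂ}

theorem sumSup_le (h : IsPuncturedRoots η n c a) :
    sumSupFundLagrange η n ≤ n + 2 * (1 + Real.log n) := by
  set ω := Complex.exp (2 * Real.pi * Complex.I / ((n + 1 : ℕ) : ℂ)) with hω
  have hprim : IsPrimitiveRoot ω (n + 1) := Complex.isPrimitiveRoot_exp _ n.succ_ne_zero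
  have hterm : ∀ i ∈ Finset.range n, 1 + 4 / (((n : ℝ) + 1) * ‖c * ω ^ (i + 1) - c‖)
      ≤ 1 + (1 / ((i : ℝ) + 1) + 1 / (((n - 1 - i : ℕ) : ℝ) + 1)) := fun i hi => by
    have hi := Finset.mem_range.mp hi
    have hin : (i : ℝ) + 1 ≤ n := by exact_mod_cast hi
    have hcast : (((n - 1 - i : ℕ) : ℝ) + 1) = n - i := by
      rw [show n - 1 - i = n - (i + 1) by omega, Nat.cast_sub (by omega)]; push_cast; ring
    have hni : 0 < (n : ℝ) - i := by linarith
    have hnorm : ‖c * ω ^ (i + 1) - c‖ = ‖ω ^ (i + 1) - 1‖ := by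
      rw [show c * ω ^ (i + 1) - c = c * (ω ^ (i + 1) - 1) by ring, norm_mul,
        h.norm_root h.pow_c, one_mul]
    rw [hcast, hnorm, add_le_add_iff_left]
    have hlow := four_mul_le_norm_exp_pow_sub_one hi
    have hpos : 0 < 4 * (((i : ℝ) + 1) * (n - i)) / ((n : ℝ) + 1) ^ 2 := by positivity
    calc 4 / (((n : ℝ) + 1) * ‖ω ^ (i + 1) - 1‖)
        ≤ 4 / (((n : ℝ) + 1) * (4 * (((i : ℝ) + 1) * (n - i)) / ((n : ℝ) + 1) ^ 2)) := by gcongr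
      _ = 1 / ((i : ℝ) + 1) + 1 / (n - i) := by field_simp; ring
  calc sumSupFundLagrange η n
      ≤ ∑ k ∈ Finset.range n, (1 + 4 / (((n : ℝ) + 1) * ‖η k - c‖)) :=
        Finset.sum_le_sum fun k hk => h.sSup_le (Finset.mem_range.mp hk)
    _ = ∑ i ∈ Finset.range n, (1 + 4 / (((n : ℝ) + 1) * ‖c * ω ^ (i + 1) - c‖)) :=
        h.sum_node_eq hprim fun w => 1 + 4 / (((n : ℝ) + 1) * ‖w - c‖)
    _ ≤ _ := Finset.sum_le_sum hterm
    _ = n + 2 * (harmonic n : ℝ) := by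
        -- The second partial fraction is the first read backwards, so each contributes one harmonic
        -- number.
        rw [Finset.sum_add_distrib, Finset.sum_add_distrib,
          Finset.sum_range_reflect (fun i : ℕ => 1 / ((i : ℝ) + 1)) n,
          sum_inv_add_one_eq_harmonic]
        simp
        ring
    _ ≤ _ := by gcongr; exact harmonic_le_one_add_log n

/-- Halfway between `c` and the adjacent node, the corresponding fundamental polynomial has
modulus larger than `1`. -/
theorem exists_one_lt_norm_eval (h : IsPuncturedRoots η n c a) (hn : 3 ≤ n) :
    ∃ k < n, ∃ z : ℂ, ‖z‖ ≤ 1 ∧ 1 < ‖(fundLagrange η n k).eval z‖ := by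
  have hn' : (3 : ℝ) ≤ n := by exact_mod_cast hn
  have hc1 := h.norm_root h.pow_c
  have hc : c ≠ 0 := by rw [← norm_pos_iff, hc1]; exact one_pos
  -- x is half the angle between adjacent roots: c u is the midpoint of the arc from c to the
  -- adjacent node c u².
  set x : ℝ := Real.pi / (n + 1) with hx
  have hx0 : 0 < x := div_pos Real.pi_pos (by positivity)
  have hxM : x * (n + 1) = Real.pi := by rw [hx]; field_simp
  -- Here 3 ≤ n enters: x ≤ π / 4. Then cos x ≥ 1 - 0.8² / 2 = 0.68.
  have hx4 : x ≤ 0.8 := by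
    rw [hx, div_le_iff₀ (by positivity)]; linarith [Real.pi_lt_d2]
  set u : ℂ := Complex.exp (Complex.I * x) with hu
  have hu1 : ‖u‖ = 1 := by rw [hu, mul_comm]; exact Complex.norm_exp_ofReal_mul_I x
  have huM : u ^ (n + 1) = -1 := by
    rw [hu, ← Complex.exp_nat_mul, ← Complex.exp_pi_mul_I, ← hxM]
    congr 1
    push_cast
    ring
  have hre : 0.68 ≤ u.re := by
    rw [hu, mul_comm, Complex.exp_ofReal_mul_I_re]
    nlinarith [Real.one_sub_sq_div_two_le_cos (x := x)]
  have hadd : 1.68 ≤ ‖u + 1‖ := by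
    refine le_trans ?_ (Complex.re_le_norm _)
    simp only [Complex.add_re, Complex.one_re]
    linarith
  have hsub : ‖u - 1‖ ≤ x := by
    refine (Real.norm_exp_I_mul_ofReal_sub_one_le).trans ?_
    rw [Real.norm_eq_abs, abs_of_pos hx0]
  have hune : u ≠ 1 := fun h1 => by
    rw [h1, one_pow] at huM
    norm_num at huM
  have hsub0 : 0 < ‖u - 1‖ := norm_pos_iff.mpr (sub_ne_zero.mpr hune)
  obtain ⟨k, hk, hkw⟩ := h.exists_node (w := c * u ^ 2)
    (by rw [mul_pow, h.pow_c, ← pow_mul, mul_comm 2, pow_mul, huM]; norm_num)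
    (fun heq => by
      have h1 : (u - 1) * (u + 1) = 0 := by
        linear_combination mul_left_cancel₀ hc (heq.trans (mul_one c).symm)
      rcases mul_eq_zero.mp h1 with h2 | h2
      · exact hune (sub_eq_zero.mp h2)
      · rw [h2, norm_zero] at hadd; norm_num at hadd)
  refine ⟨k, hk, c * u, by rw [norm_mul, hc1, hu1, one_mul], ?_⟩
  have h1 := h.norm_fundLagrange_eval hk (c * u)
  have h2 : ‖omitProd η n k (c * u)‖ * ‖u - 1‖ * ‖u - 1‖ = 2 := by
    have h3 := congrArg norm (h.omitProd_mul_node hk (c * u))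
    rw [hkw, mul_pow, h.pow_c, huM, norm_mul, norm_mul,
      show c * u - c = c * (u - 1) by ring, show c * u - c * u ^ 2 = -(c * u * (u - 1)) by ring,
      show a * -1 - a = -(2 * a) by ring, norm_neg, norm_neg, norm_mul, norm_mul, norm_mul,
      norm_mul, hc1, hu1, h.norm_eq] at h3
    simpa using h3
  have h4 : ‖η k - c‖ = ‖u - 1‖ * ‖u + 1‖ := by
    rw [hkw, show c * u ^ 2 - c = c * ((u - 1) * (u + 1)) by ring, norm_mul, norm_mul, hc1,
      one_mul]
  rw [h4] at h1
  have h5 : ‖(fundLagrange η n k).eval (c * u)‖ * ((n + 1) * ‖u - 1‖) = 2 * ‖u + 1‖ := by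
    rw [← mul_assoc, h1, ← h2]; ring
  have h6 : ((n : ℝ) + 1) * ‖u - 1‖ ≤ 3.15 := by
    have := mul_le_mul_of_nonneg_left hsub (show (0 : ℝ) ≤ n + 1 by positivity)
    linarith [Real.pi_lt_d2]
  -- The value at c u is 2 ‖u + 1‖ / ((n + 1) ‖u - 1‖), at least 3.36 / 3.15.
  by_contra! hle
  have h7 := mul_le_mul hle h6 (by positivity) zero_le_one
  linarith

theorem lt_sumSup (h : IsPuncturedRoots η n c a) (hn : 3 ≤ n) :
    (n : ℝ) < sumSupFundLagrange η n := by
  obtain ⟨k, hk, z, hz, hlt⟩ := h.exists_one_lt_norm_eval hn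
  calc (n : ℝ) = ∑ k ∈ Finset.range n, (1 : ℝ) := by simp
    _ < _ := Finset.sum_lt_sum (fun j hj => ?_)
      ⟨k, Finset.mem_range.mpr hk, hlt.trans_le (h.norm_eval_le_sSup hk hz)⟩
  have hj := Finset.mem_range.mp hj
  have h1 := h.norm_eval_le_sSup hj (h.norm_root (h.pow_node hj)).le
  rwa [h.fundLagrange_eval_node hj, norm_one] at h1

end IsPuncturedRoots

/-! ### Application to Leja sequences and the limit -/

theorem IsLejaSequence.isPuncturedRoots {η : ℕ → ℂ}
    (h : IsLejaSequence (Metric.closedBall (0 : ℂ) 1) η) (p : ℕ) :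
    IsPuncturedRoots η (2 ^ p - 1) (η (2 ^ p - 1)) (η 0 ^ 2 ^ p) := by
  have hs := h.isLejaSection (2 ^ p)
  have h1 : 2 ^ p - 1 + 1 = 2 ^ p := Nat.sub_add_cancel Nat.one_le_two_pow
  refine ⟨by rw [norm_pow, hs.norm_zero, one_pow], (h.isLejaSection _).injOn,
    fun k hk heq => hk.ne (hs.injOn ?_ ?_ heq), fun z => ?_⟩
  · exact Finset.mem_coe.mpr (Finset.mem_range.mpr (by omega))
  · exact Finset.mem_coe.mpr (Finset.mem_range.mpr (by omega))
  · rw [← Finset.prod_range_succ (fun j => z - η j), h1, IsLejaSection.prod_sub_eq p η hs z]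

/-- The rate `2 (1 + log (2 ^ p - 1)) / (2 ^ p - 1)`, as a function of `1 / p`. -/
noncomputable def lejaRate (x : ℝ) : ℝ :=
  2 * (1 + Real.log ((2 : ℝ) ^ (1 / x) - 1)) / ((2 : ℝ) ^ (1 / x) - 1)

theorem lejaRate_one_div (p : ℕ) :
    lejaRate (1 / (p : ℝ)) = 2 * (1 + Real.log ((2 : ℝ) ^ p - 1)) / ((2 : ℝ) ^ p - 1) := by
  rw [lejaRate, one_div_one_div, Real.rpow_natCast]

theorem tendsto_lejaRate : Tendsto (fun p : ℕ => lejaRate (1 / (p : ℝ))) atTop (𝓝 0) := by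
  have h1 : Tendsto (fun p : ℕ => (2 : ℝ) ^ p - 1) atTop atTop :=
    tendsto_atTop_add_const_right _ _ (tendsto_pow_atTop_atTop_of_one_lt one_lt_two)
  have h2 : Tendsto (fun y : ℝ => 2 * (1 / y + Real.log y / y)) atTop (𝓝 0) := by
    have h3 : Tendsto (fun y : ℝ => Real.log y / y) atTop (𝓝 0) :=
      Real.isLittleO_log_id_atTop.tendsto_div_nhds_zero
    have h4 : Tendsto (fun y : ℝ => 1 / y) atTop (𝓝 0) := by
      simpa using tendsto_inv_atTop_zero (𝕜 := ℝ)
    simpa using (h4.add h3).const_mul 2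
  refine (h2.comp h1).congr fun p => ?_
  rw [lejaRate_one_div, Function.comp_apply]
  ring


theorem mainTheorem2 :
    ∃ ε : ℝ → ℝ, Tendsto (fun p : ℕ => ε (1 / (p : ℝ))) atTop (𝓝 0) ∧
      ∀ η : ℕ → ℂ, IsLejaSequence (Metric.closedBall (0 : ℂ) 1) η →
        Tendsto (fun p : ℕ => 1 / ((2 : ℝ) ^ p - 1) * sumSupFundLagrange η (2 ^ p - 1))
          atTop (𝓝 1) ∧
        ∀ p : ℕ, 2 ≤ p →
          (2 : ℝ) ^ p - 1 < sumSupFundLagrange η (2 ^ p - 1) ∧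
          sumSupFundLagrange η (2 ^ p - 1) ≤ (1 + ε (1 / (p : ℝ))) * ((2 : ℝ) ^ p - 1) := by
  have hcast : ∀ p : ℕ, ((2 ^ p - 1 : ℕ) : ℝ) = (2 : ℝ) ^ p - 1 := fun p => by
    rw [Nat.cast_sub Nat.one_le_two_pow]; simp
  refine ⟨lejaRate, tendsto_lejaRate, fun η hη => ?_⟩
  have hpos : ∀ p : ℕ, 2 ≤ p → (0 : ℝ) < 2 ^ p - 1 := fun p hp => by
    linarith [one_lt_pow₀ (one_lt_two (α := ℝ)) (show p ≠ 0 by omega)]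
  have hbounds : ∀ p : ℕ, 2 ≤ p → (2 : ℝ) ^ p - 1 < sumSupFundLagrange η (2 ^ p - 1) ∧
      sumSupFundLagrange η (2 ^ p - 1) ≤ (1 + lejaRate (1 / (p : ℝ))) * ((2 : ℝ) ^ p - 1) := by
    intro p hp
    have hroots := hη.isPuncturedRoots p
    have h4 : 2 ^ 2 ≤ 2 ^ p := Nat.pow_le_pow_right two_pos hp
    refine ⟨hcast p ▸ hroots.lt_sumSup (by omega), hroots.sumSup_le.trans_eq ?_⟩
    rw [hcast, lejaRate_one_div, add_mul, div_mul_cancel₀ _ (hpos p hp).ne', one_mul]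
  refine ⟨?_, hbounds⟩
  have hlim : Tendsto (fun p : ℕ => 1 + lejaRate (1 / (p : ℝ))) atTop (𝓝 1) := by
    simpa using tendsto_lejaRate.const_add 1
  -- Squeeze between 1 and 1 + `lejaRate (1 / p)`; the bounds are available only for p ≥ 2, which
  -- suffices eventually.
  refine tendsto_of_tendsto_of_tendsto_of_le_of_le' tendsto_const_nhds hlim ?_ ?_
  · filter_upwards [eventually_ge_atTop 2] with p hp
    rw [one_div_mul_eq_div, le_div_iff₀ (hpos p hp), one_mul]
    exact (hbounds p hp).1.le
  · filter_upwards [eventually_ge_atTop 2] with p hp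
    rw [one_div_mul_eq_div, div_le_iff₀ (hpos p hp)]
    exact (hbounds p hp).2
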